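/- **Definitions.** A *$T$-space* is a pair $(X,T)$, where $X$ is a compact Hausdorff space and $T$ is a continuous fixed-point free involution of $X$; the sphere $S^m$ carries the antipodal involution. A map between such spaces is *equivariant* if it is continuous and commutes with the involutions. The *Conner–Floyd index and coindex* are $$\mathrm{ind}(X,T)=\max\{m\ge 0 : \text{there is an equivariant map } S^m\to X\},\qquad \mathrm{coind}(X,T)=\min\{m\ge 0 : \text{there is an equivariant map } X\to S^m\},$$ with values in $\mathbb N\cup\{\infty\}$. Let $K$ be a finite simplicial complex with a simplicial involution $T$ that maps no simplex to itself, and use $\mathbb Z_2$ coefficients. Let $H_m(K,T)=Z_m(K,T)/B_m(K,T)$ be the homology of the complex of $T$-invariant chains. The index $\nu(c)\in\mathbb Z_2$ of $c\in Z_m(K,T)$ is defined by writing $c=d+T(d)$ with an $m$-chain $d$: it is the number of vertices in $d$ modulo $2$ if $m=0$, and $\nu(\partial d)$ if $m>0$; it induces $\nu:H_m(K,T)\to\mathbb Z_2$. For a $T$-space $(X,T)$, let $H_m(X,T)$ be the inverse limit of the groups $H_m(K,T)$ over the nerves $K$ of the finite open covers of $X$ whose members are permuted by $T$ and are disjoint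 from their images under $T$, with the induced homomorphism $\nu:H_m(X,T)\to\mathbb Z_2$. The *Yang index* $\nu(X,T)\in\mathbb N\cup\{\infty\}$ is the largest $m$ with $\nu(H_m(X,T))\ne\{0\}$. For $0\le k\le n$, let $G(n,k)$ be the space of oriented $k$-dimensional linear subspaces of $\mathbb R^n$, with the involution that reverses orientation. That is, for $k>0$, $G(n,k)=St(n,k)/SO(k)$, where $St(n,k)$ is the space of real $n\times k$ matrices with orthonormal columns, $SO(k)$ acts on the right, and the involution is induced by negating the last column; and $G(n,0)=\{1,-1\}$ with the involution $\varepsilon\mapsto-\varepsilon$. **Proposition 4.2 (Grassmannian monotonicity).** Let $0\le k\le n$. (a) For each $n$ and $k$, the Conner–Floyd index, the Yang index and the coindex of $G(n,k)$ are equal, respectively, to those of $G(n,n-k)$. (b) For each $k$, the Conner–Floyd index, the Yang index and the coindex of $G(n,k)$ are each nondecreasing in $n$ (for $n\ge k$). (c) For each $n$ and $k$, the Conner–Floyd index, the Yang index and the coindex of $G(n+\ell,k+\ell)$ are each nondecreasing in $\ell\ge 0$. -/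

import Mathlib

namespace Yang

/-! ## `T`-spaces -/

universe u v w

/-- A `T`-space: a compact Hausdorff space with a continuous fixed-point free involution. -/
structure TSpace : Type (u + 1) where
  carrier : Type u
  [top : TopologicalSpace carrier]
  [compact : CompactSpace carrier]
  [t2 : T2Space carrier]
  /-- the involution -/
  T : carrier → carrier
  continuous_T : Continuous T
  involutive_T : Function.Involutive T
  T_ne : ∀ x, T x ≠ x

attribute [instance] TSpace.top TSpace.compact TSpace.t2

/-- There is a continuous equivariant map `X → Y`. -/
def EquivariantlyMaps (X : TSpace.{u}) (Y : TSpace.{v}) : Prop :=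
  ∃ f : C(X.carrier, Y.carrier), ∀ x, f (X.T x) = Y.T (f x)

/-- The unit sphere `S^n` of `ℝ^(n+1)` with the antipodal involution. -/
noncomputable def sphere (n : ℕ) : TSpace.{0} where
  carrier := Metric.sphere (0 : EuclideanSpace ℝ (Fin (n + 1))) 1
  T x := -x
  continuous_T := continuous_neg
  involutive_T := neg_neg
  T_ne x h := by
    exact ne_neg_of_mem_unit_sphere ℝ x h.symm

/-! ## Conner--Floyd index and coindex -/

/-- The Conner--Floyd index: the largest `n` (or `∞`) with an equivariant map `S^n → X`. -/
noncomputable def ind (X : TSpace.{u}) : ℕ∞ :=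
  sSup {N : ℕ∞ | ∃ n : ℕ, N = n ∧ EquivariantlyMaps (sphere n) X}

/-- The Conner--Floyd coindex: the least `n` with an equivariant map `X → S^n`, and `∞` if there
is none. -/
noncomputable def coind (X : TSpace.{u}) : ℕ∞ :=
  sInf {N : ℕ∞ | ∃ n : ℕ, N = n ∧ EquivariantlyMaps X (sphere n)}

/-! ## Invariant simplicial chains modulo two -/

/-- Chains modulo two (in all dimensions at once) on the nonempty finite subsets of `V`. -/
abbrev Chain (V : Type u) : Type u := Finset V →₀ ZMod 2

/-- The simplicial boundary: a simplex goes to the sum of its codimension one faces. The empty face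
is left out, so the boundary of a vertex is zero. -/
noncomputable def boundary (V : Type u) [DecidableEq V] : Chain V →+ Chain V :=
  Finsupp.liftAddHom fun s : Finset V =>
    ∑ v ∈ s, if (s.erase v).Nonempty then Finsupp.singleAddHom (s.erase v) else 0

/-- The chain map induced by a map of vertices: a simplex goes to its image if the map is injective
on it, and to zero otherwise. -/
noncomputable def push {V : Type u} {W : Type v} [DecidableEq W] (p : V → W) :
    Chain V →+ Chain W :=
  Finsupp.liftAddHom fun s : Finset V =>
    if (s.image p).card = s.card then Finsupp.singleAddHom (s.image p) else 0

/-- An (abstract) simplicial complex with a simplicial involution that maps no simplex to itself,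
which says that the induced involution of the geometric realization has no fixed points. -/
structure TComplex (V : Type u) [DecidableEq V] extends PreAbstractSimplicialComplex V where
  τ : V → V
  involutive_τ : Function.Involutive τ
  image_τ_mem : ∀ s ∈ faces, s.image τ ∈ faces
  image_τ_ne : ∀ s ∈ faces, s.image τ ≠ s

/-- A simplicial map that commutes with the involutions. -/
structure TComplex.Hom {V : Type u} {W : Type v} [DecidableEq V] [DecidableEq W]
    (K : TComplex V) (L : TComplex W) where
  toFun : V → W
  image_mem : ∀ s ∈ K.faces, s.image toFun ∈ L.faces
  comm : ∀ x, toFun (K.τ x) = L.τ (toFun x)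

section Chains

variable {V : Type u} [DecidableEq V] (K : TComplex V)

/-- The `m`-chains of `K`. -/
def TComplex.chains (m : ℕ) : AddSubgroup (Chain V) where
  carrier := {c | ∀ s, c s ≠ 0 → s ∈ K.faces ∧ s.card = m + 1}
  add_mem' {a b} ha hb s hs := by
    by_cases h : a s = 0
    · exact hb s fun h' => hs (by simp [h, h'])
    · exact ha s h
  zero_mem' s hs := absurd rfl hs
  neg_mem' {a} ha s hs := ha s (by simpa using hs)

/-- The invariant `m`-chains `C_m(K, T)`. -/
noncomputable def TComplex.invChains (m : ℕ) : AddSubgroup (Chain V) :=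
  K.chains m ⊓ AddMonoidHom.eqLocus (push K.τ) (AddMonoidHom.id _)

/-- The invariant cycles `Z_m(K, T)`. -/
noncomputable def TComplex.cycles (m : ℕ) : AddSubgroup (Chain V) :=
  K.invChains m ⊓ (boundary V).ker

/-- The boundaries `B_m(K, T)` of invariant `(m+1)`-chains. -/
noncomputable def TComplex.boundaries (m : ℕ) : AddSubgroup (Chain V) :=
  (K.invChains (m + 1)).map (boundary V)

/-- The `T`-homology group `H_m(K, T) = Z_m(K, T) / B_m(K, T)`. -/
abbrev TComplex.Homology (m : ℕ) : Type u :=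
  K.cycles m ⧸ (K.boundaries m).addSubgroupOf (K.cycles m)

/-- `K.HasIndex m c ε` says that the invariant `m`-cycle `c` has index `ν(c) = ε`: split `c` as
`d + T(d)` with an `m`-chain `d`; for `m = 0` the index is the parity of the number of vertices
in `d`, and for `m > 0` it is the index of `∂d`. (It does not depend on the splittings.) -/
def TComplex.HasIndex : ℕ → Chain V → ZMod 2 → Prop
  | 0, c, ε => ∃ d ∈ K.chains 0, c = d + push K.τ d ∧ ε = d.sum fun _ a => a
  | m + 1, c, ε => ∃ d ∈ K.chains (m + 1), c = d + push K.τ d ∧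
      TComplex.HasIndex m (boundary V d) ε

/-- The `T`-homology class `a` has index `ε`: it is represented by a cycle of index `ε`. (It does
not depend on the representative.) -/
def TComplex.ClassHasIndex (m : ℕ) (a : K.Homology m) (ε : ZMod 2) : Prop :=
  ∃ z : K.cycles m, QuotientAddGroup.mk z = a ∧ K.HasIndex m (z : Chain V) ε

end Chains

section Functoriality

theorem push_single {V : Type u} {W : Type v} [DecidableEq W] (p : V → W) (s : Finset V) :
    push p (Finsupp.single s 1) =
      if (s.image p).card = s.card then Finsupp.single (s.image p) (1 : ZMod 2) else 0 := by
  rw [push, Finsupp.liftAddHom_apply_single]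
  split_ifs <;> rfl

theorem hom_ext {V : Type u} {M : Type w} [AddCommGroup M] {f g : Chain V →+ M}
    (h : ∀ s, f (Finsupp.single s 1) = g (Finsupp.single s 1)) : f = g := by
  refine Finsupp.addHom_ext fun s a => ?_
  obtain rfl | rfl : a = 0 ∨ a = 1 := by revert a; decide
  · simp
  · exact h s

theorem push_push {V : Type u} {W : Type v} {X : Type w} [DecidableEq W] [DecidableEq X]
    (p : V → W) (q : W → X) (c : Chain V) :
    push q (push p c) = push (q ∘ p) c := by
  suffices h : (push q).comp (push p) = push (q ∘ p) from DFunLike.congr_fun h c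
  refine hom_ext fun s => ?_
  simp only [AddMonoidHom.comp_apply]
  rw [push_single, push_single]
  by_cases h : (s.image p).card = s.card
  · rw [if_pos h, push_single, Finset.image_image, h]
  · rw [if_neg h, map_zero, if_neg]
    intro h'
    have h1 : (s.image (q ∘ p)).card ≤ (s.image p).card := by
      rw [← Finset.image_image]
      exact Finset.card_image_le
    exact h (le_antisymm Finset.card_image_le (h' ▸ h1))

variable {V : Type u} {W : Type v} [DecidableEq V] [DecidableEq W]

theorem boundary_single (s : Finset V) :
    boundary V (Finsupp.single s 1) =
      ∑ v ∈ s, if (s.erase v).Nonempty then Finsupp.single (s.erase v) (1 : ZMod 2) else 0 := by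
  rw [boundary, Finsupp.liftAddHom_apply_single, AddMonoidHom.finsetSum_apply]
  refine Finset.sum_congr rfl fun v _ => ?_
  split_ifs <;> rfl

theorem boundary_push (p : V → W) (c : Chain V) :
    boundary W (push p c) = push p (boundary V c) := by
  suffices h : (boundary W).comp (push p) = (push p).comp (boundary V) from
    DFunLike.congr_fun h c
  refine hom_ext fun s => ?_
  simp only [AddMonoidHom.comp_apply]
  rw [push_single, boundary_single, map_sum]
  have key : ∀ v, push p (if (s.erase v).Nonempty then Finsupp.single (s.erase v) (1 : ZMod 2)
      else 0) = if (s.erase v).Nonempty ∧ Set.InjOn p (s.erase v) then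
        Finsupp.single ((s.erase v).image p) (1 : ZMod 2) else 0 := by
    intro v
    by_cases h : (s.erase v).Nonempty
    · simp only [h, if_true, true_and]
      rw [push_single]
      simp only [Finset.card_image_iff]
    · simp [h]
  simp only [key]
  by_cases hinj : Set.InjOn p s
  · rw [if_pos (Finset.card_image_iff.2 hinj), boundary_single, Finset.sum_image hinj]
    refine Finset.sum_congr rfl fun v hv => ?_
    have h1 : (s.image p).erase (p v) = (s.erase v).image p := by
      ext w
      simp only [Finset.mem_erase, Finset.mem_image]
      constructor
      · rintro ⟨hw, x, hx, rfl⟩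
        exact ⟨x, ⟨fun h => hw (by rw [h]), hx⟩, rfl⟩
      · rintro ⟨x, ⟨hxv, hx⟩, rfl⟩
        exact ⟨fun h => hxv (hinj hx hv h), x, hx, rfl⟩
    have h2 : Set.InjOn p (s.erase v) := hinj.mono (by simp)
    rw [h1]
    simp only [h2, and_true, Finset.image_nonempty]
  · rw [if_neg (fun h => hinj (Finset.card_image_iff.1 h)), map_zero]
    symm
    obtain ⟨x, hx, y, hy, hxy, hne⟩ : ∃ x ∈ s, ∃ y ∈ s, p x = p y ∧ x ≠ y := by
      simpa [Set.InjOn, not_forall] using hinj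
    have h0 : ∀ v ∈ s, v ∉ ({x, y} : Finset V) →
        (if (s.erase v).Nonempty ∧ Set.InjOn p (s.erase v) then
          Finsupp.single ((s.erase v).image p) (1 : ZMod 2) else 0) = 0 := by
      intro v _ hv
      simp only [Finset.mem_insert, Finset.mem_singleton, not_or] at hv
      refine if_neg fun h => hne (h.2 ?_ ?_ hxy)
      · simp [hx, Ne.symm hv.1]
      · simp [hy, Ne.symm hv.2]
    have hsub : ({x, y} : Finset V) ⊆ s := by
      intro z hz
      simp only [Finset.mem_insert, Finset.mem_singleton] at hz
      rcases hz with rfl | rfl <;> assumption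
    rw [← Finset.sum_subset hsub h0, Finset.sum_pair hne]
    have himg : ∀ {a b : V}, a ∈ s → b ∈ s → p a = p b → a ≠ b →
        (s.erase a).image p = s.image p := by
      intro a b _ hb hab hne'
      ext w
      simp only [Finset.mem_image, Finset.mem_erase]
      constructor
      · rintro ⟨z, ⟨_, hz⟩, rfl⟩
        exact ⟨z, hz, rfl⟩
      · rintro ⟨z, hz, rfl⟩
        by_cases hza : z = a
        · exact ⟨b, ⟨hne'.symm, hb⟩, by rw [hza, hab]⟩
        · exact ⟨z, ⟨hza, hz⟩, rfl⟩
    have hnx : (s.erase x).Nonempty := ⟨y, by simp [hy, hne.symm]⟩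
    have hny : (s.erase y).Nonempty := ⟨x, by simp [hx, hne]⟩
    have hix : Set.InjOn p (s.erase x) ↔ Set.InjOn p (s.erase y) := by
      rw [← Finset.card_image_iff, ← Finset.card_image_iff, himg hx hy hxy hne,
        himg hy hx hxy.symm hne.symm, Finset.card_erase_of_mem hx, Finset.card_erase_of_mem hy]
    rw [himg hx hy hxy hne, himg hy hx hxy.symm hne.symm]
    simp only [hnx, hny, true_and, hix]
    split_ifs
    · rw [← Finsupp.single_add, CharTwo.add_self_eq_zero, Finsupp.single_zero]
    · simp

variable {K : TComplex V} {L : TComplex W} (f : K.Hom L)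

theorem push_mem_chains {m : ℕ} {c : Chain V} (hc : c ∈ K.chains m) :
    push f.toFun c ∈ L.chains m := by
  rw [push, Finsupp.liftAddHom_apply, Finsupp.sum]
  refine AddSubgroup.sum_mem _ fun s hs => ?_
  obtain ⟨hs1, hs2⟩ := hc s (Finsupp.mem_support_iff.1 hs)
  split_ifs with h
  · intro t ht
    have hts : s.image f.toFun = t := by
      by_contra hne
      exact ht (Finsupp.single_eq_of_ne' hne)
    exact hts ▸ ⟨f.image_mem s hs1, h.trans hs2⟩
  · exact AddSubgroup.zero_mem _

theorem push_mem_invChains {m : ℕ} {c : Chain V} (hc : c ∈ K.invChains m) :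
    push f.toFun c ∈ L.invChains m := by
  refine ⟨push_mem_chains f hc.1, ?_⟩
  have h1 : push K.τ c = c := hc.2
  have h2 : L.τ ∘ f.toFun = f.toFun ∘ K.τ := funext fun x => (f.comm x).symm
  change push L.τ (push f.toFun c) = push f.toFun c
  rw [push_push, h2, ← push_push, h1]

theorem push_mem_cycles {m : ℕ} {c : Chain V} (hc : c ∈ K.cycles m) :
    push f.toFun c ∈ L.cycles m := by
  refine ⟨push_mem_invChains f hc.1, ?_⟩
  have h1 : boundary V c = 0 := hc.2
  change boundary W (push f.toFun c) = 0
  rw [boundary_push, h1, map_zero]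

theorem push_mem_boundaries {m : ℕ} {c : Chain V} (hc : c ∈ K.boundaries m) :
    push f.toFun c ∈ L.boundaries m := by
  obtain ⟨d, hd, rfl⟩ := hc
  exact ⟨push f.toFun d, push_mem_invChains f hd, boundary_push _ _⟩

/-- The map `H_m(K, T) → H_m(L, T)` induced by an equivariant simplicial map. -/
noncomputable def TComplex.Hom.homologyMap (m : ℕ) : K.Homology m →+ L.Homology m :=
  QuotientAddGroup.map _ _
    (((push f.toFun).comp (K.cycles m).subtype).codRestrict (L.cycles m)
      fun z => push_mem_cycles f z.2)
    fun _ hz => push_mem_boundaries f hz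

end Functoriality

/-! ## Čech--Smith `T`-homology and the Yang index -/

/-- A finite open cover `(U_i)` of a `T`-space whose members are permuted by the involution, no
member meeting its image. -/
structure TCover (X : TSpace.{u}) : Type u where
  N : ℕ
  U : Fin N → Set X.carrier
  isOpen_U : ∀ i, IsOpen (U i)
  exists_mem : ∀ x, ∃ i, x ∈ U i
  σ : Fin N → Fin N
  involutive_σ : Function.Involutive σ
  σ_ne : ∀ i, σ i ≠ i
  U_σ : ∀ i, U (σ i) = X.T ⁻¹' U i
  disjoint_U : ∀ i, Disjoint (U i) (U (σ i))

/-- The nerve of a cover: the nonempty sets of indices whose members have a common point. -/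
def TCover.nerve {X : TSpace.{u}} (𝒰 : TCover X) : TComplex (Fin 𝒰.N) where
  faces := {s | s.Nonempty ∧ ∃ x, ∀ i ∈ s, x ∈ 𝒰.U i}
  isRelLowerSet_faces := by
    rintro s ⟨hs, x, hx⟩
    exact ⟨hs, fun t hts ht => ⟨ht, x, fun i hi => hx i (hts hi)⟩⟩
  τ := 𝒰.σ
  involutive_τ := 𝒰.involutive_σ
  image_τ_mem := by
    rintro s ⟨hs, x, hx⟩
    refine ⟨hs.image _, X.T x, fun i hi => ?_⟩
    obtain ⟨j, hj, rfl⟩ := Finset.mem_image.1 hi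
    rw [𝒰.U_σ, Set.mem_preimage, X.involutive_T x]
    exact hx j hj
  image_τ_ne := by
    rintro s ⟨⟨i, hi⟩, x, hx⟩ h
    have h1 : 𝒰.σ i ∈ s := h ▸ Finset.mem_image_of_mem _ hi
    exact Set.disjoint_left.1 (𝒰.disjoint_U i) (hx i hi) (hx _ h1)

/-- An equivariant projection from a cover `𝒱` to a cover `𝒰` that it refines. -/
structure TCover.Refinement {X : TSpace.{u}} (𝒱 𝒰 : TCover X) where
  toFun : Fin 𝒱.N → Fin 𝒰.N
  subset : ∀ i, 𝒱.U i ⊆ 𝒰.U (toFun i)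
  comm : ∀ i, toFun (𝒱.σ i) = 𝒰.σ (toFun i)

/-- The simplicial map of nerves given by a refinement. -/
def TCover.Refinement.nerveHom {X : TSpace.{u}} {𝒱 𝒰 : TCover X} (p : 𝒱.Refinement 𝒰) :
    𝒱.nerve.Hom 𝒰.nerve where
  toFun := p.toFun
  image_mem := by
    rintro s ⟨hs, x, hx⟩
    refine ⟨hs.image _, x, fun i hi => ?_⟩
    obtain ⟨j, hj, rfl⟩ := Finset.mem_image.1 hi
    exact p.subset j (hx j hj)
  comm := p.comm

/-- The `T`-homology group `H_m(X, T)`: the inverse limit of the groups `H_m(nerve of 𝒰, T)` over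
the covers `𝒰`, ordered by refinement. -/
noncomputable def homology (X : TSpace.{u}) (m : ℕ) :
    AddSubgroup (∀ 𝒰 : TCover X, 𝒰.nerve.Homology m) where
  carrier := {a | ∀ (𝒱 𝒰 : TCover X) (p : 𝒱.Refinement 𝒰), p.nerveHom.homologyMap m (a 𝒱) = a 𝒰}
  add_mem' ha hb 𝒱 𝒰 p := by simp [ha 𝒱 𝒰 p, hb 𝒱 𝒰 p]
  zero_mem' 𝒱 𝒰 p := by simp
  neg_mem' ha 𝒱 𝒰 p := by simp [ha 𝒱 𝒰 p]

/-- The class `a ∈ H_m(X, T)` has index `ν(a) = ε`. Simplicial equivariant maps preserve the index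
and any two covers have a common refinement, so the index is the same at all covers. -/
def HasIndex (X : TSpace.{u}) (m : ℕ) (a : homology X m) (ε : ZMod 2) : Prop :=
  ∀ 𝒰 : TCover X, 𝒰.nerve.ClassHasIndex m (a.1 𝒰) ε

/-- The Yang index `ν(X, T)`: the largest `m` (or `∞`) such that some class in `H_m(X, T)` has
nonzero index. -/
noncomputable def yangIndex (X : TSpace.{u}) : ℕ∞ :=
  sSup {N : ℕ∞ | ∃ m : ℕ, N = m ∧ ∃ a : homology X m, HasIndex X m a 1}

/-! ## Stiefel manifolds and oriented Grassmannians -/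

open Matrix

/-- The Stiefel manifold `St(n, k)`: the `n × k` real matrices with orthonormal columns. -/
abbrev Stiefel (n k : ℕ) : Type := {V : Matrix (Fin n) (Fin k) ℝ // Vᵀ * V = 1}

/-- Two frames span the same oriented plane: they differ by the right action of `SO(k)`. -/
def sameOrientedPlane (n k : ℕ) : Setoid (Stiefel n k) where
  r V W := ∃ A ∈ Matrix.specialOrthogonalGroup (Fin k) ℝ, W.1 = V.1 * A
  iseqv := by
    refine ⟨fun V => ⟨1, one_mem _, by simp⟩, ?_, ?_⟩
    · rintro V W ⟨A, hA, h⟩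
      refine ⟨(star (⟨A, hA⟩ : Matrix.specialOrthogonalGroup (Fin k) ℝ)).1, Subtype.property _, ?_⟩
      have h1 : A * star A = 1 := (Matrix.mem_unitaryGroup_iff).1 hA.1
      change V.1 = W.1 * star A
      rw [h, Matrix.mul_assoc, h1, Matrix.mul_one]
    · rintro V W X ⟨A, hA, h⟩ ⟨B, hB, h'⟩
      exact ⟨A * B, mul_mem hA hB, by rw [h', h, Matrix.mul_assoc]⟩

/-- The quotient space `St(n, k) / SO(k)`. -/
abbrev StiefelModSO (n k : ℕ) : Type := Quotient (sameOrientedPlane n k)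

theorem det_of_orthogonal {k : ℕ} {A : Matrix (Fin k) (Fin k) ℝ}
    (hA : A ∈ Matrix.specialOrthogonalGroup (Fin k) ℝ) : Aᵀ * A = 1 ∧ A * Aᵀ = 1 ∧ A.det = 1 :=
  ⟨(Matrix.mem_orthogonalGroup_iff' _ _).1 hA.1, (Matrix.mem_orthogonalGroup_iff _ _).1 hA.1, hA.2⟩

/-- `V` and `W` span the same oriented plane iff `A = VᵀW` has determinant one and `W = VA`. -/
theorem sameOrientedPlane_iff {n k : ℕ} (V W : Stiefel n k) :
    sameOrientedPlane n k V W ↔ V.1 * (V.1ᵀ * W.1) = W.1 ∧ (V.1ᵀ * W.1).det = 1 := by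
  constructor
  · rintro ⟨A, hA, h⟩
    have h1 : V.1ᵀ * W.1 = A := by rw [h, ← Matrix.mul_assoc, V.2, Matrix.one_mul]
    rw [h1]
    exact ⟨h.symm, (det_of_orthogonal hA).2.2⟩
  · rintro ⟨h1, h2⟩
    refine ⟨V.1ᵀ * W.1, ⟨(Matrix.mem_orthogonalGroup_iff' _ _).2 ?_, h2⟩, h1.symm⟩
    rw [Matrix.transpose_mul, Matrix.transpose_transpose, Matrix.mul_assoc, h1, W.2]

/-- The right action of an orthogonal matrix on frames. -/
def Stiefel.mulRight {n k : ℕ} (V : Stiefel n k) (A : Matrix (Fin k) (Fin k) ℝ)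
    (hA : Aᵀ * A = 1) : Stiefel n k :=
  ⟨V.1 * A, by rw [Matrix.transpose_mul, Matrix.mul_assoc, ← Matrix.mul_assoc V.1ᵀ, V.2,
    Matrix.one_mul, hA]⟩

theorem Stiefel.continuous_mulRight {n k : ℕ} (A : Matrix (Fin k) (Fin k) ℝ) (hA : Aᵀ * A = 1) :
    Continuous fun V : Stiefel n k => V.mulRight A hA :=
  (continuous_subtype_val.matrix_mul continuous_const).subtype_mk _

instance compactSpace_stiefel (n k : ℕ) : CompactSpace (Stiefel n k) := by
  suffices h : IsCompact {V : Matrix (Fin n) (Fin k) ℝ | Vᵀ * V = 1} from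
    isCompact_iff_compactSpace.1 h
  have hK : IsCompact (Set.univ.pi fun _ : Fin n => Set.univ.pi fun _ : Fin k =>
      Set.Icc (-1 : ℝ) 1) := isCompact_univ_pi fun _ => isCompact_univ_pi fun _ => isCompact_Icc
  refine hK.of_isClosed_subset ?_ ?_
  · exact isClosed_eq (continuous_id.matrix_transpose.matrix_mul continuous_id) continuous_const
  · intro V hV i _ j _
    have h1 : ∑ l, V l j * V l j = 1 := by
      have := congrFun (congrFun hV j) j
      rwa [Matrix.one_apply_eq] at this
    have h2 : V i j * V i j ≤ 1 := by
      rw [← h1]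
      exact Finset.single_le_sum (f := fun l => V l j * V l j) (fun l _ => mul_self_nonneg _)
        (Finset.mem_univ i)
    exact ⟨by nlinarith, by nlinarith⟩

theorem isOpenQuotientMap_mk (n k : ℕ) :
    IsOpenQuotientMap (Quotient.mk (sameOrientedPlane n k)) := by
  refine ⟨Quotient.mk_surjective, continuous_quotient_mk', fun U hU => ?_⟩
  have hq : Topology.IsQuotientMap (Quotient.mk (sameOrientedPlane n k)) := isQuotientMap_quotient_mk'
  rw [← hq.isOpen_preimage]
  have h : Quotient.mk (sameOrientedPlane n k) ⁻¹' (Quotient.mk (sameOrientedPlane n k) '' U) =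
      ⋃ (A : Matrix (Fin k) (Fin k) ℝ) (hA : A ∈ Matrix.specialOrthogonalGroup (Fin k) ℝ),
        (fun V : Stiefel n k => V.mulRight A (det_of_orthogonal hA).1) ⁻¹' U := by
    ext V
    simp only [Set.mem_preimage, Set.mem_image, Set.mem_iUnion]
    constructor
    · rintro ⟨W, hW, h⟩
      obtain ⟨A, hA, h'⟩ := Quotient.exact h.symm
      have h2 : W = V.mulRight A (det_of_orthogonal hA).1 := Subtype.ext h'
      exact ⟨A, hA, h2 ▸ hW⟩
    · rintro ⟨A, hA, h⟩
      exact ⟨_, h, (Quotient.sound (s := sameOrientedPlane n k) (a := V)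
        (b := V.mulRight A (det_of_orthogonal hA).1) ⟨A, hA, rfl⟩).symm⟩
  rw [h]
  exact isOpen_iUnion fun A => isOpen_iUnion fun hA =>
    hU.preimage (Stiefel.continuous_mulRight A (det_of_orthogonal hA).1)

instance t2Space_stiefelModSO (n k : ℕ) : T2Space (StiefelModSO n k) := by
  rw [t2Space_iff_of_isOpenQuotientMap (isOpenQuotientMap_mk n k)]
  have h : {q : Stiefel n k × Stiefel n k | Quotient.mk (sameOrientedPlane n k) q.1 =
      Quotient.mk (sameOrientedPlane n k) q.2} =
      {q : Stiefel n k × Stiefel n k |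
        q.1.1 * (q.1.1ᵀ * q.2.1) = q.2.1 ∧ (q.1.1ᵀ * q.2.1).det = 1} := by
    ext q
    exact Quotient.eq.trans (sameOrientedPlane_iff _ _)
  rw [h]
  have h1 : Continuous fun q : Stiefel n k × Stiefel n k => q.1.1 :=
    continuous_subtype_val.comp continuous_fst
  have h2 : Continuous fun q : Stiefel n k × Stiefel n k => q.2.1 :=
    continuous_subtype_val.comp continuous_snd
  have h3 := h1.matrix_transpose.matrix_mul h2
  exact (isClosed_eq (h1.matrix_mul h3) h2).inter (isClosed_eq h3.matrix_det continuous_const)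

/-- The diagonal matrix `diag(1, …, 1, -1)`. -/
def flipLast (k : ℕ) : Matrix (Fin (k + 1)) (Fin (k + 1)) ℝ :=
  Matrix.diagonal fun j => if j = Fin.last k then -1 else 1

theorem flipLast_mul_self (k : ℕ) : flipLast k * flipLast k = 1 := by
  rw [flipLast, Matrix.diagonal_mul_diagonal, ← Matrix.diagonal_one]
  congr 1
  ext j
  split_ifs <;> norm_num

theorem flipLast_transpose (k : ℕ) : (flipLast k)ᵀ = flipLast k := Matrix.diagonal_transpose _

theorem flipLast_orthogonal (k : ℕ) : (flipLast k)ᵀ * flipLast k = 1 := by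
  rw [flipLast_transpose, flipLast_mul_self]

theorem det_flipLast (k : ℕ) : (flipLast k).det = -1 := by
  rw [flipLast, Matrix.det_diagonal, Finset.prod_ite_eq' Finset.univ (Fin.last k)]
  simp

/-- The involution `S(v_1, …, v_k) = (v_1, …, v_(k-1), -v_k)` of the Stiefel manifold. -/
def Stiefel.S {n k : ℕ} (V : Stiefel n (k + 1)) : Stiefel n (k + 1) :=
  V.mulRight (flipLast k) (flipLast_orthogonal k)

/-- The reversal of orientation on `St(n, k) / SO(k)`, induced by `S`. -/
def StiefelModSO.reverse {n k : ℕ} : StiefelModSO n (k + 1) → StiefelModSO n (k + 1) :=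
  Quotient.map Stiefel.S fun V W => by
    rintro ⟨A, hA, h⟩
    obtain ⟨h1, _, h3⟩ := det_of_orthogonal hA
    refine ⟨flipLast k * A * flipLast k, ⟨(Matrix.mem_orthogonalGroup_iff' _ _).2 ?_, ?_⟩, ?_⟩
    · rw [Matrix.transpose_mul, Matrix.transpose_mul, flipLast_transpose]
      calc flipLast k * (Aᵀ * flipLast k) * (flipLast k * A * flipLast k)
          = flipLast k * (Aᵀ * (flipLast k * flipLast k) * A) * flipLast k := by simp only [Matrix.mul_assoc]
        _ = 1 := by rw [flipLast_mul_self, Matrix.mul_one, h1, Matrix.mul_one, flipLast_mul_self]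
    · change (flipLast k * A * flipLast k).det = 1
      rw [Matrix.det_mul, Matrix.det_mul, det_flipLast, h3]
      norm_num
    · change W.1 * flipLast k = V.1 * flipLast k * (flipLast k * A * flipLast k)
      rw [h]
      symm
      calc V.1 * flipLast k * (flipLast k * A * flipLast k)
          = V.1 * ((flipLast k * flipLast k) * A) * flipLast k := by simp only [Matrix.mul_assoc]
        _ = V.1 * A * flipLast k := by rw [flipLast_mul_self, Matrix.one_mul]

/-- The oriented Grassmannian `G(n, k)` with the involution that reverses orientation: the two
orientations `±1` of the zero space for `k = 0`, and `St(n, k) / SO(k)` for `k > 0`. -/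
def orientedGrassmannian : ℕ → ℕ → TSpace.{0}
  | _, 0 =>
    { carrier := ℤˣ
      T := fun ε => -ε
      continuous_T := continuous_of_discreteTopology
      involutive_T := neg_neg
      T_ne := by decide }
  | n, k + 1 =>
    { carrier := StiefelModSO n (k + 1)
      T := StiefelModSO.reverse
      continuous_T := continuous_quotient_mk'.comp
        (Stiefel.continuous_mulRight _ (flipLast_orthogonal k)) |>.quotient_lift _
      involutive_T := by
        rintro ⟨V⟩
        refine congrArg (Quotient.mk _) (Subtype.ext ?_)
        change V.1 * flipLast k * flipLast k = V.1
        rw [Matrix.mul_assoc, flipLast_mul_self, Matrix.mul_one]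
      T_ne := by
        rintro ⟨V⟩ h
        have h1 := ((sameOrientedPlane_iff _ _).1 (Quotient.exact h.symm)).2
        change (V.1ᵀ * (V.1 * flipLast k)).det = 1 at h1
        rw [← Matrix.mul_assoc, V.2, Matrix.one_mul, det_flipLast] at h1
        norm_num at h1 }

end Yang

/-!
All three invariants are monotone under equivariant maps: if `X` maps equivariantly to `Y`, then
`ind X ≤ ind Y`, `coind X ≤ coind Y` and `yangIndex X ≤ yangIndex Y`. For the index and the coindex
this is composition of maps. For the Yang index, a finite `T`-cover of `Y` pulls back along
`f : X → Y` to a `T`-cover of `X` with the same index set, and the nerve of the pullback is a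
subcomplex of the nerve of the original cover. Pushing classes along these inclusions is compatible
with refinements and preserves the index `ν`, so it carries a class of index one in `H_m(X, T)` to a
class of index one in `H_m(Y, T)` (`EquivariantlyMaps.yangIndex_le`).

It remains to find equivariant maps between Grassmannians. Appending a zero row to a frame maps
`G(n, k)` to `G(n + 1, k)`, and taking oriented orthogonal complements maps `G(k + l, k)` to
`G(k + l, l)`. The complement is described by the relation `IsComplement V W` between frames: the
square matrix `[V | W]` is orthogonal of determinant one. This is a closed relation between compact
spaces and determines the oriented plane of `W` from that of `V`, so the induced map is continuous
(`continuous_of_isClosed_rel`) without a choice of frames depending continuously on `V`. Changing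
the sign of the last columns of both `V` and `W` keeps the relation, which gives equivariance.

The monotonicity of `G(n + ℓ, k + ℓ)` in `ℓ` is the monotonicity of `G(n + ℓ, n - k)` in the
dimension of the ambient space, by duality.
-/

namespace Yang

open Matrix

universe u v w

/-! ### Monotonicity of the index and the coindex -/

theorem EquivariantlyMaps.refl (X : TSpace.{u}) : EquivariantlyMaps X X :=
  ⟨ContinuousMap.id _, fun _ => rfl⟩

theorem EquivariantlyMaps.trans {X : TSpace.{u}} {Y : TSpace.{v}} {Z : TSpace.{w}}
    (h : EquivariantlyMaps X Y) (h' : EquivariantlyMaps Y Z) : EquivariantlyMaps X Z := by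
  obtain ⟨f, hf⟩ := h
  obtain ⟨g, hg⟩ := h'
  exact ⟨g.comp f, fun x => by simp [hf, hg]⟩

theorem EquivariantlyMaps.ind_le {X : TSpace.{u}} {Y : TSpace.{v}} (h : EquivariantlyMaps X Y) :
    ind X ≤ ind Y := by
  refine sSup_le_sSup ?_
  rintro N ⟨n, hN, hn⟩
  exact ⟨n, hN, hn.trans h⟩

theorem EquivariantlyMaps.coind_le {X : TSpace.{u}} {Y : TSpace.{v}} (h : EquivariantlyMaps X Y) :
    coind X ≤ coind Y := by
  refine sInf_le_sInf ?_
  rintro N ⟨n, hN, hn⟩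
  exact ⟨n, hN, h.trans hn⟩

/-! ### Monotonicity of the Yang index -/

section Index

variable {V : Type u} {W : Type v} [DecidableEq V] [DecidableEq W]
  {K : TComplex V} {L : TComplex W}

theorem TComplex.Hom.push_push_comm (f : K.Hom L) (d : Chain V) :
    push L.τ (push f.toFun d) = push f.toFun (push K.τ d) := by
  rw [push_push, push_push]
  exact congrArg (fun p => push p d) (funext fun x => (f.comm x).symm)

/-- An equivariant simplicial map preserves the number of vertices of a `0`-chain modulo two. -/
theorem sum_push_of_mem_chains_zero (p : V → W) {d : Chain V} (hd : d ∈ K.chains 0) :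
    ((push p d).sum fun _ a => a) = d.sum fun _ a => a := by
  have hsum : ∀ c : Chain W,
      (c.sum fun _ a => a) = Finsupp.liftAddHom (fun _ => AddMonoidHom.id (ZMod 2)) c :=
    fun _ => rfl
  have hpush : push p d = d.sum fun s a => (if (s.image p).card = s.card then
      Finsupp.singleAddHom (s.image p) else 0 : ZMod 2 →+ Chain W) a := rfl
  rw [hsum, hpush, Finsupp.sum, map_sum, Finsupp.sum]
  refine Finset.sum_congr rfl fun s hs => ?_
  obtain ⟨v, rfl⟩ := Finset.card_eq_one.1 (hd s (Finsupp.mem_support_iff.1 hs)).2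
  simp

/-- Equivariant simplicial maps preserve the index of invariant cycles. -/
theorem TComplex.HasIndex.push (f : K.Hom L) {m : ℕ} {c : Chain V} {ε : ZMod 2}
    (h : K.HasIndex m c ε) : L.HasIndex m (push f.toFun c) ε := by
  induction m generalizing c with
  | zero =>
    obtain ⟨d, hd, hc, hε⟩ := h
    refine ⟨Yang.push f.toFun d, push_mem_chains f hd, ?_, ?_⟩
    · rw [hc, map_add, f.push_push_comm]
    · rw [hε, sum_push_of_mem_chains_zero _ hd]
  | succ m ih =>
    obtain ⟨d, hd, hc, hε⟩ := h
    refine ⟨Yang.push f.toFun d, push_mem_chains f hd, ?_, ?_⟩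
    · rw [hc, map_add, f.push_push_comm]
    · rw [boundary_push]
      exact ih hε

theorem TComplex.ClassHasIndex.homologyMap (f : K.Hom L) {m : ℕ} {a : K.Homology m} {ε : ZMod 2}
    (h : K.ClassHasIndex m a ε) : L.ClassHasIndex m (f.homologyMap m a) ε := by
  obtain ⟨z, rfl, hz⟩ := h
  exact ⟨⟨Yang.push f.toFun z, push_mem_cycles f z.2⟩, rfl, hz.push f⟩

theorem TComplex.Hom.homologyMap_mk (f : K.Hom L) (m : ℕ) (z : K.cycles m) :
    f.homologyMap m (QuotientAddGroup.mk z) =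
      QuotientAddGroup.mk ⟨push f.toFun z, push_mem_cycles f z.2⟩ :=
  rfl

/-- The map on homology depends on the composite vertex map only. -/
theorem TComplex.Hom.homologyMap_homologyMap {V₁ : Type u} {V₂ : Type v} [DecidableEq V₁]
    [DecidableEq V₂] {K₁ : TComplex V₁} {K₂ : TComplex V₂} (f : K.Hom K₁) (g : K₁.Hom L)
    (f' : K.Hom K₂) (g' : K₂.Hom L) (h : g.toFun ∘ f.toFun = g'.toFun ∘ f'.toFun) {m : ℕ}
    (a : K.Homology m) :
    g.homologyMap m (f.homologyMap m a) = g'.homologyMap m (f'.homologyMap m a) := by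
  obtain ⟨z, rfl⟩ := QuotientAddGroup.mk_surjective a
  simp only [homologyMap_mk]
  refine congrArg _ (Subtype.ext ?_)
  simp only [push_push, h]

end Index

section Pullback

variable {X : TSpace.{u}} {Y : TSpace.{v}} (f : C(X.carrier, Y.carrier))
  (hf : ∀ x, f (X.T x) = Y.T (f x))

/-- The pullback of a `T`-cover along an equivariant map, with the same index set. -/
def TCover.pullback (𝒰 : TCover Y) : TCover X where
  N := 𝒰.N
  U i := f ⁻¹' 𝒰.U i
  isOpen_U i := (𝒰.isOpen_U i).preimage f.continuous
  exists_mem x := 𝒰.exists_mem (f x)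
  σ := 𝒰.σ
  involutive_σ := 𝒰.involutive_σ
  σ_ne := 𝒰.σ_ne
  U_σ i := by
    ext x
    simp [𝒰.U_σ, hf]
  disjoint_U i := (𝒰.disjoint_U i).preimage f

/-- The nerve of the pullback of a cover is a subcomplex of the nerve of the cover. -/
def TCover.pullbackHom (𝒰 : TCover Y) : (𝒰.pullback f hf).nerve.Hom 𝒰.nerve where
  toFun i := i
  image_mem := by
    rintro s ⟨hs, x, hx⟩
    refine ⟨hs.image _, f x, fun i hi => ?_⟩
    obtain ⟨j, hj, rfl⟩ := Finset.mem_image.1 hi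
    exact hx j hj
  comm _ := rfl

/-- The pullback of a refinement. -/
def TCover.Refinement.pullback {𝒱 𝒰 : TCover Y} (p : 𝒱.Refinement 𝒰) :
    (𝒱.pullback f hf).Refinement (𝒰.pullback f hf) where
  toFun := p.toFun
  subset i := Set.preimage_mono (p.subset i)
  comm := p.comm

end Pullback

theorem EquivariantlyMaps.yangIndex_le {X : TSpace.{u}} {Y : TSpace.{v}}
    (h : EquivariantlyMaps X Y) : yangIndex X ≤ yangIndex Y := by
  obtain ⟨f, hf⟩ := h
  refine sSup_le_sSup ?_
  rintro N ⟨m, hN, a, ha⟩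
  refine ⟨m, hN, ⟨fun 𝒰 => (𝒰.pullbackHom f hf).homologyMap m (a.1 (𝒰.pullback f hf)), ?_⟩,
    fun 𝒰 => (ha (𝒰.pullback f hf)).homologyMap _⟩
  intro 𝒱 𝒰 p
  dsimp only
  rw [← a.2 _ _ (p.pullback f hf)]
  exact TComplex.Hom.homologyMap_homologyMap (𝒱.pullbackHom f hf) p.nerveHom
    (p.pullback f hf).nerveHom (𝒰.pullbackHom f hf) rfl _

/-! ### Adding a dimension to the ambient space -/

/-- A `k`-frame of `ℝ^n` as a frame of `ℝ^(n+1)`, by a zero row at the end. -/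
def Stiefel.snocZero {n k : ℕ} (V : Stiefel n k) : Stiefel (n + 1) k :=
  ⟨Matrix.of fun i j => Fin.snoc (α := fun _ => ℝ) (fun i => V.1 i j) 0 i, by
    refine Eq.trans ?_ V.2
    ext i j
    simp [Matrix.mul_apply, Fin.sum_univ_castSucc]⟩

theorem Stiefel.snocZero_mul {n k : ℕ} {V W : Stiefel n k} {A : Matrix (Fin k) (Fin k) ℝ}
    (h : W.1 = V.1 * A) : W.snocZero.1 = V.snocZero.1 * A := by
  ext i j
  refine Fin.lastCases ?_ (fun i => ?_) i
  · simp [snocZero, Matrix.mul_apply]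
  · simp [snocZero, h, Matrix.mul_apply]

theorem Stiefel.continuous_snocZero {n k : ℕ} :
    Continuous (Stiefel.snocZero : Stiefel n k → Stiefel (n + 1) k) := by
  refine Continuous.subtype_mk (continuous_matrix fun (i : Fin (n + 1)) (j : Fin k) => ?_) _
  refine Fin.lastCases ?_ (fun i => ?_) i
  · simpa using continuous_const (X := Stiefel n k) (y := (0 : ℝ))
  · have h : Continuous fun V : Stiefel n k => V.1 := continuous_subtype_val
    simpa using h.matrix_elem i j

theorem equivariantlyMaps_add_one (n k : ℕ) :
    EquivariantlyMaps (orientedGrassmannian n k) (orientedGrassmannian (n + 1) k) := by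
  cases k with
  | zero => exact .refl _
  | succ k =>
    refine ⟨⟨Quotient.map Stiefel.snocZero fun V W => ?_, ?_⟩, ?_⟩
    · rintro ⟨A, hA, h⟩
      exact ⟨A, hA, Stiefel.snocZero_mul h⟩
    · exact (continuous_quotient_mk'.comp Stiefel.continuous_snocZero).quotient_lift _
    · rintro ⟨V⟩
      exact congrArg (Quotient.mk _) (Subtype.ext (Stiefel.snocZero_mul rfl))

/-! ### Oriented orthogonal complements -/

/-- A function that is determined by a closed relation to a compact space is continuous. -/
theorem continuous_of_isClosed_rel {X : Type u} {Y : Type v} {Z : Type w} [TopologicalSpace X]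
    [TopologicalSpace Y] [CompactSpace Y] [TopologicalSpace Z] {R : Set (X × Y)} (hR : IsClosed R)
    {f : X → Z} {g : Y → Z} (hg : Continuous g) (hex : ∀ x, ∃ y, (x, y) ∈ R)
    (hfg : ∀ x y, (x, y) ∈ R → f x = g y) : Continuous f := by
  refine continuous_iff_isClosed.2 fun C hC => ?_
  have h : f ⁻¹' C = Prod.fst '' (R ∩ {q | g q.2 ∈ C}) := by
    ext x
    constructor
    · intro hx
      obtain ⟨y, hy⟩ := hex x
      exact ⟨(x, y), ⟨hy, by simpa [hfg x y hy] using hx⟩, rfl⟩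
    · rintro ⟨⟨x, y⟩, ⟨hy, hC⟩, rfl⟩
      exact (congrArg (· ∈ C) (hfg x y hy)).mpr hC
  rw [h]
  exact isClosedMap_fst_of_compactSpace _ (hR.inter (hC.preimage (hg.comp continuous_snd)))

section Complement

variable {k l : ℕ}

/-- The square matrix `[V | W]`. -/
def joinFrames (V : Stiefel (k + l) k) (W : Stiefel (k + l) l) :
    Matrix (Fin (k + l)) (Fin (k + l)) ℝ :=
  (fromCols V.1 W.1).submatrix id finSumFinEquiv.symm

/-- The frame `W` spans the oriented orthogonal complement of the span of the frame `V`: the spans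
are orthogonal and `[V | W]` has determinant one. -/
def IsComplement (V : Stiefel (k + l) k) (W : Stiefel (k + l) l) : Prop :=
  V.1ᵀ * W.1 = 0 ∧ (joinFrames V W).det = 1

theorem isClosed_isComplement :
    IsClosed {q : Stiefel (k + l) k × Stiefel (k + l) l | IsComplement q.1 q.2} := by
  have h1 : Continuous fun q : Stiefel (k + l) k × Stiefel (k + l) l => q.1.1 :=
    continuous_subtype_val.comp continuous_fst
  have h2 : Continuous fun q : Stiefel (k + l) k × Stiefel (k + l) l => q.2.1 :=
    continuous_subtype_val.comp continuous_snd
  have h3 : Continuous fun q : Stiefel (k + l) k × Stiefel (k + l) l => joinFrames q.1 q.2 := by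
    refine Continuous.matrix_submatrix (continuous_matrix fun i j => ?_) _ _
    cases j with
    | inl j => exact h1.matrix_elem i j
    | inr j => exact h2.matrix_elem i j
  exact (isClosed_eq (h1.matrix_transpose.matrix_mul h2) continuous_const).inter
    (isClosed_eq h3.matrix_det continuous_const)

theorem joinFrames_transpose_mul (V V' : Stiefel (k + l) k) (W W' : Stiefel (k + l) l) :
    (joinFrames V W)ᵀ * joinFrames V' W' =
      (fromBlocks (V.1ᵀ * V'.1) (V.1ᵀ * W'.1) (W.1ᵀ * V'.1) (W.1ᵀ * W'.1)).submatrix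
        finSumFinEquiv.symm finSumFinEquiv.symm := by
  rw [joinFrames, joinFrames, transpose_submatrix, transpose_fromCols, ← fromRows_mul_fromCols]
  exact submatrix_mul_equiv _ _ _ (Equiv.refl _) _

theorem joinFrames_mul_transpose (V : Stiefel (k + l) k) (W : Stiefel (k + l) l) :
    joinFrames V W * (joinFrames V W)ᵀ = V.1 * V.1ᵀ + W.1 * W.1ᵀ := by
  rw [joinFrames, transpose_submatrix, transpose_fromCols, submatrix_mul_equiv,
    fromCols_mul_fromRows, submatrix_id_id]

/-- Frames with orthogonal spans of complementary dimensions form an orthogonal matrix. -/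
theorem joinFrames_transpose_mul_self {V : Stiefel (k + l) k} {W : Stiefel (k + l) l}
    (h : V.1ᵀ * W.1 = 0) : (joinFrames V W)ᵀ * joinFrames V W = 1 := by
  have h' : W.1ᵀ * V.1 = 0 := by
    rw [← transpose_transpose (W.1ᵀ * V.1), transpose_mul, transpose_transpose, h, transpose_zero]
  rw [joinFrames_transpose_mul, V.2, W.2, h, h', fromBlocks_one, submatrix_one_equiv]

/-- The oriented complement depends on the oriented plane only. -/
theorem IsComplement.sameOrientedPlane {V V' : Stiefel (k + l) k} {W W' : Stiefel (k + l) l}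
    (h : IsComplement V W) (h' : IsComplement V' W') (hV : sameOrientedPlane (k + l) k V V') :
    sameOrientedPlane (k + l) l W W' := by
  obtain ⟨h1, h2⟩ := (sameOrientedPlane_iff _ _).1 hV
  set A := V.1ᵀ * V'.1 with hA
  -- `V` and `V'` span the same plane, so `W'` is orthogonal to `V` as well.
  have hVW' : V.1ᵀ * W'.1 = 0 := by
    have hA1 : Aᵀ * A = 1 := by
      rw [hA, transpose_mul, transpose_transpose, Matrix.mul_assoc, h1, V'.2]
    have hA2 : A * Aᵀ = 1 := mul_eq_one_comm.1 hA1
    have hVA : V.1 = V'.1 * Aᵀ := by rw [← h1, Matrix.mul_assoc, hA2, Matrix.mul_one]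
    rw [hVA, transpose_mul, Matrix.mul_assoc, h'.1, Matrix.mul_zero]
  have hW' : W.1 * (W.1ᵀ * W'.1) = W'.1 := by
    have h3 := mul_eq_one_comm.1 (joinFrames_transpose_mul_self h.1)
    rw [joinFrames_mul_transpose] at h3
    calc W.1 * (W.1ᵀ * W'.1) = V.1 * (V.1ᵀ * W'.1) + W.1 * (W.1ᵀ * W'.1) := by
          rw [hVW', Matrix.mul_zero, zero_add]
      _ = (V.1 * V.1ᵀ + W.1 * W.1ᵀ) * W'.1 := by simp only [Matrix.add_mul, Matrix.mul_assoc]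
      _ = W'.1 := by rw [h3, Matrix.one_mul]
  refine (sameOrientedPlane_iff _ _).2 ⟨hW', ?_⟩
  -- `[V | W]ᵀ [V' | W']` is block triangular with diagonal blocks `VᵀV'` and `WᵀW'`.
  have h4 := congrArg det (joinFrames_transpose_mul V V' W W')
  rw [det_mul, det_transpose, h.2, h'.2, det_submatrix_equiv_self, hVW', det_fromBlocks_zero₁₂,
    ← hA, h2] at h4
  linarith

end Complement

theorem det_joinFrames_S {k l : ℕ} (V : Stiefel (k + (l + 1)) k)
    (W : Stiefel (k + (l + 1)) (l + 1)) :
    (joinFrames V W.S).det = -(joinFrames V W).det := by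
  have h : fromCols V.1 W.S.1 = fromCols V.1 W.1 *
      (fromBlocks 1 0 0 (flipLast l) : Matrix (Fin k ⊕ Fin (l + 1)) (Fin k ⊕ Fin (l + 1)) ℝ) := by
    rw [fromCols_mul_fromBlocks]
    simp [Stiefel.S, Stiefel.mulRight]
  rw [joinFrames, h, ← submatrix_mul_equiv _ _ _ finSumFinEquiv.symm, det_mul,
    det_submatrix_equiv_self, det_fromBlocks_zero₁₂, det_one, det_flipLast, joinFrames]
  ring

theorem det_joinFrames_S_left {k l : ℕ} (V : Stiefel (k + 1 + l) (k + 1))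
    (W : Stiefel (k + 1 + l) l) :
    (joinFrames V.S W).det = -(joinFrames V W).det := by
  have h : fromCols V.S.1 W.1 = fromCols V.1 W.1 *
      (fromBlocks (flipLast k) 0 0 1 : Matrix (Fin (k + 1) ⊕ Fin l) (Fin (k + 1) ⊕ Fin l) ℝ) := by
    rw [fromCols_mul_fromBlocks]
    simp [Stiefel.S, Stiefel.mulRight]
  rw [joinFrames, h, ← submatrix_mul_equiv _ _ _ finSumFinEquiv.symm, det_mul,
    det_submatrix_equiv_self, det_fromBlocks_zero₁₂, det_one, det_flipLast, joinFrames]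
  ring

/-- Negating the last columns of both frames changes the sign of `det [V | W]` twice. -/
theorem IsComplement.S {k l : ℕ} {V : Stiefel (k + 1 + (l + 1)) (k + 1)}
    {W : Stiefel (k + 1 + (l + 1)) (l + 1)} (h : IsComplement V W) : IsComplement V.S W.S := by
  refine ⟨?_, by rw [det_joinFrames_S, det_joinFrames_S_left, h.2, neg_neg]⟩
  change (V.1 * flipLast k)ᵀ * (W.1 * flipLast l) = 0
  rw [transpose_mul, Matrix.mul_assoc, ← Matrix.mul_assoc V.1ᵀ, h.1, Matrix.zero_mul,
    Matrix.mul_zero]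

/-- Orthonormal columns extend to an orthonormal basis. -/
theorem exists_transpose_mul_eq_zero {k l : ℕ} (V : Stiefel (k + l) k) :
    ∃ W : Stiefel (k + l) l, V.1ᵀ * W.1 = 0 := by
  let v : Fin k ⊕ Fin l → EuclideanSpace ℝ (Fin (k + l)) :=
    Sum.elim (fun j => WithLp.toLp 2 (V.1.col j)) 0
  have hv : Orthonormal ℝ ((Set.range (Sum.inl : Fin k → Fin k ⊕ Fin l)).domRestrict v) := by
    rw [orthonormal_iff_ite]
    rintro ⟨_, i, rfl⟩ ⟨_, j, rfl⟩
    have h := congrFun (congrFun V.2 i) j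
    simp only [Matrix.mul_apply, transpose_apply, one_apply] at h
    simpa [v, PiLp.inner_apply, mul_comm, Subtype.ext_iff] using h
  obtain ⟨b, hb⟩ := hv.exists_orthonormalBasis_extension_of_card_eq (by simp)
  have hinner : ∀ s t, ∑ i, b s i * b t i = if s = t then 1 else 0 := fun s t => by
    have := orthonormal_iff_ite.1 b.orthonormal s t
    simpa [PiLp.inner_apply, mul_comm] using this
  refine ⟨⟨Matrix.of fun i j => b (.inr j) i, ?_⟩, ?_⟩
  · ext i j
    simpa [Matrix.mul_apply, one_apply] using hinner (.inr i) (.inr j)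
  · ext i j
    have h := hinner (.inl i) (.inr j)
    rw [hb _ ⟨i, rfl⟩] at h
    simpa [Matrix.mul_apply, v] using h

theorem det_eq_one_or_neg_one {n : ℕ} {A : Matrix (Fin n) (Fin n) ℝ} (h : Aᵀ * A = 1) :
    A.det = 1 ∨ A.det = -1 := by
  have := congrArg det h
  rw [det_mul, det_transpose, det_one] at this
  exact mul_self_eq_one_iff.1 this

theorem exists_isComplement {k l : ℕ} (V : Stiefel (k + (l + 1)) k) :
    ∃ W : Stiefel (k + (l + 1)) (l + 1), IsComplement V W := by
  obtain ⟨W, hW⟩ := exists_transpose_mul_eq_zero V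
  rcases det_eq_one_or_neg_one (joinFrames_transpose_mul_self hW) with h | h
  · exact ⟨W, hW, h⟩
  · refine ⟨W.S, ?_, by rw [det_joinFrames_S, h, neg_neg]⟩
    change V.1ᵀ * (W.1 * flipLast l) = 0
    rw [← Matrix.mul_assoc, hW, Matrix.zero_mul]

theorem equivariantlyMaps_complement_succ (k l : ℕ) :
    EquivariantlyMaps (orientedGrassmannian (k + 1 + (l + 1)) (k + 1))
      (orientedGrassmannian (k + 1 + (l + 1)) (l + 1)) := by
  choose c hc using exists_isComplement (k := k + 1) (l := l)
  have hmk : ∀ V W, IsComplement V W →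
      Quotient.mk (sameOrientedPlane _ _) (c V) = Quotient.mk (sameOrientedPlane _ _) W :=
    fun V W h => Quotient.sound ((hc V).sameOrientedPlane h ((sameOrientedPlane _ _).refl V))
  have hcont : Continuous fun V => Quotient.mk (sameOrientedPlane _ _) (c V) :=
    continuous_of_isClosed_rel isClosed_isComplement continuous_quotient_mk' exists_isComplement hmk
  refine ⟨⟨Quotient.map c fun V V' h => (hc V).sameOrientedPlane (hc V') h,
    hcont.quotient_lift _⟩, ?_⟩
  rintro ⟨V⟩
  exact hmk _ _ (hc V).S

/-! ### The oriented planes of dimension and codimension zero -/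

theorem equivariantlyMaps_of_zero (n : ℕ) (X : TSpace.{u}) [Nonempty X.carrier] :
    EquivariantlyMaps (orientedGrassmannian n 0) X := by
  obtain ⟨x⟩ := ‹Nonempty X.carrier›
  let f : ℤˣ → X.carrier := fun ε => if ε = 1 then x else X.T x
  have hf : Continuous f := continuous_of_discreteTopology
  refine ⟨⟨f, hf⟩, fun (ε : ℤˣ) => ?_⟩
  change f (-ε) = X.T (f ε)
  rcases Int.units_eq_one_or ε with rfl | rfl
  · exact if_neg (by decide)
  · simp [f, X.involutive_T x]

instance nonempty_stiefel_self (n : ℕ) : Nonempty (Stiefel n n) :=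
  ⟨⟨1, by simp⟩⟩

/-- An oriented frame of the whole space is classified by the sign of its determinant. -/
theorem equivariantlyMaps_self_zero (n : ℕ) :
    EquivariantlyMaps (orientedGrassmannian n n) (orientedGrassmannian n 0) := by
  cases n with
  | zero => exact .refl _
  | succ n =>
    have hex : ∀ V : Stiefel (n + 1) (n + 1), ∃ ε : ℤˣ, V.1.det = ((ε : ℤ) : ℝ) := by
      intro V
      rcases det_eq_one_or_neg_one V.2 with h | h
      · exact ⟨1, by simp [h]⟩
      · exact ⟨-1, by simp [h]⟩
    choose s hs using hex
    have huniq : ∀ V (ε : ℤˣ), V.1.det = ((ε : ℤ) : ℝ) → s V = ε := fun V ε h =>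
      Units.ext (Int.cast_injective ((hs V).symm.trans h))
    have hclosed : IsClosed {q : Stiefel (n + 1) (n + 1) × ℤˣ | q.1.1.det = ((q.2 : ℤ) : ℝ)} :=
      isClosed_eq (continuous_subtype_val.comp continuous_fst).matrix_det
        ((continuous_of_discreteTopology (f := fun ε : ℤˣ => ((ε : ℤ) : ℝ))).comp continuous_snd)
    have hcont : Continuous s := continuous_of_isClosed_rel hclosed continuous_id
      (fun V => ⟨s V, hs V⟩) huniq
    refine ⟨⟨Quotient.lift s ?_, hcont.quotient_lift _⟩, ?_⟩
    · rintro V W ⟨A, hA, h⟩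
      refine huniq V (s W) ?_
      rw [← hs W, h, det_mul, (det_of_orthogonal hA).2.2, mul_one]
    · rintro ⟨V⟩
      refine huniq V.S (-s V) ?_
      change (V.1 * flipLast n).det = _
      rw [det_mul, det_flipLast, hs V]
      simp

/-! ### Duality -/

theorem equivariantlyMaps_complement (k l : ℕ) :
    EquivariantlyMaps (orientedGrassmannian (k + l) k) (orientedGrassmannian (k + l) l) := by
  cases k with
  | zero =>
    cases l with
    | zero => exact .refl _
    | succ l =>
      rw [Nat.zero_add]
      have : Nonempty (orientedGrassmannian (l + 1) (l + 1)).carrier :=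
        (nonempty_stiefel_self (l + 1)).map (Quotient.mk _)
      exact equivariantlyMaps_of_zero _ _
  | succ k =>
    cases l with
    | zero => exact equivariantlyMaps_self_zero _
    | succ l => exact equivariantlyMaps_complement_succ k l

theorem equivariantlyMaps_sub {n k : ℕ} (h : k ≤ n) :
    EquivariantlyMaps (orientedGrassmannian n k) (orientedGrassmannian n (n - k)) := by
  obtain ⟨l, rfl⟩ := Nat.exists_eq_add_of_le h
  rw [Nat.add_sub_cancel_left]
  exact equivariantlyMaps_complement k l

theorem equivariantlyMaps_of_sub {n k : ℕ} (h : k ≤ n) :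
    EquivariantlyMaps (orientedGrassmannian n (n - k)) (orientedGrassmannian n k) := by
  simpa [Nat.sub_sub_self h] using equivariantlyMaps_sub (Nat.sub_le n k)

/-- Adding a dimension to both the plane and the ambient space is dual to adding one to the ambient
space only. -/
theorem equivariantlyMaps_add_one_add_one {n k : ℕ} (h : k ≤ n) :
    EquivariantlyMaps (orientedGrassmannian n k) (orientedGrassmannian (n + 1) (k + 1)) := by
  have h1 := equivariantlyMaps_of_sub (Nat.succ_le_succ h)
  rw [Nat.succ_sub_succ] at h1
  exact ((equivariantlyMaps_sub h).trans (equivariantlyMaps_add_one n (n - k))).trans h1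

end Yang

theorem proposition4p2 :
    -- (a) `G(n, k)` and `G(n, n - k)` have the same indices and coindex
    (∀ n k : ℕ, k ≤ n →
      Yang.ind (Yang.orientedGrassmannian n k) = Yang.ind (Yang.orientedGrassmannian n (n - k)) ∧
      Yang.yangIndex (Yang.orientedGrassmannian n k) =
        Yang.yangIndex (Yang.orientedGrassmannian n (n - k)) ∧
      Yang.coind (Yang.orientedGrassmannian n k) =
        Yang.coind (Yang.orientedGrassmannian n (n - k))) ∧
    -- (b) those of `G(n, k)` are nondecreasing in `n`, for `n ≥ k`
    (∀ k : ℕ,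
      MonotoneOn (fun n => Yang.ind (Yang.orientedGrassmannian n k)) (Set.Ici k) ∧
      MonotoneOn (fun n => Yang.yangIndex (Yang.orientedGrassmannian n k)) (Set.Ici k) ∧
      MonotoneOn (fun n => Yang.coind (Yang.orientedGrassmannian n k)) (Set.Ici k)) ∧
    -- (c) those of `G(n + ℓ, k + ℓ)` are nondecreasing in `ℓ`
    (∀ n k : ℕ, k ≤ n →
      Monotone (fun ℓ : ℕ => Yang.ind (Yang.orientedGrassmannian (n + ℓ) (k + ℓ))) ∧
      Monotone (fun ℓ : ℕ => Yang.yangIndex (Yang.orientedGrassmannian (n + ℓ) (k + ℓ))) ∧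
      Monotone (fun ℓ : ℕ => Yang.coind (Yang.orientedGrassmannian (n + ℓ) (k + ℓ)))) := by
  refine ⟨fun n k h => ?_, fun k => ?_, fun n k h => ?_⟩
  · have h1 := Yang.equivariantlyMaps_sub h
    have h2 := Yang.equivariantlyMaps_of_sub h
    exact ⟨h1.ind_le.antisymm h2.ind_le, h1.yangIndex_le.antisymm h2.yangIndex_le,
      h1.coind_le.antisymm h2.coind_le⟩
  · have h := fun n => Yang.equivariantlyMaps_add_one n k
    exact ⟨(monotone_nat_of_le_succ fun n => (h n).ind_le).monotoneOn _,
      (monotone_nat_of_le_succ fun n => (h n).yangIndex_le).monotoneOn _,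
      (monotone_nat_of_le_succ fun n => (h n).coind_le).monotoneOn _⟩
  · have h1 := fun ℓ : ℕ => Yang.equivariantlyMaps_add_one_add_one (Nat.add_le_add_right h ℓ)
    exact ⟨monotone_nat_of_le_succ fun ℓ => (h1 ℓ).ind_le,
      monotone_nat_of_le_succ fun ℓ => (h1 ℓ).yangIndex_le,
      monotone_nat_of_le_succ fun ℓ => (h1 ℓ).coind_le⟩
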